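/- Let $k$ be an algebraically closed field, let $n\ge 4$, and let $\Gamma\subset\mathbb{P}^n_k$ be a set of $n+3$ distinct points in general linear position, i.e. no $n+1$ points of $\Gamma$ lie on a common hyperplane. Let $J=\bigcap_{p\in\Gamma}I(p)\subset R=k[x_0,\ldots,x_n]$ be the homogeneous defining ideal of $\Gamma$, let $\Theta=(\partial g_i/\partial x_j)$ be the Jacobian matrix of a finite set of generators $g_1,\ldots,g_m$ of $J$, and let $I=(J,I_n(\Theta))$ be the Jacobian ideal of $J$, where $I_n(\Theta)$ is the ideal generated by the $n$-minors of $\Theta$. Then the pair $J\subset I$ is Aluffi torsion-free: its Valabrega--Valla module $$\bigoplus_{t\ge 2}\frac{J\cap I^t}{J\,I^{t-1}}$$ is zero. -/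

import Mathlib

open scoped LinearAlgebra.Projectivization

noncomputable section

namespace AluffiPoints

/-- A finite set `Γ` of points of `ℙⁿ` is in general linear position if either `|Γ| ≤ n` and the
points span a linear subspace of projective dimension `|Γ| - 1`, or `|Γ| ≥ n + 1` and no `n + 1`
points of `Γ` lie on a common hyperplane (the zero locus of a nonzero linear form). -/
def InGeneralLinearPosition {k : Type*} [Field k] {n : ℕ}
    (Γ : Finset (ℙ k (Fin (n + 1) → k))) : Prop :=
  (Γ.card ≤ n ∧
    Module.finrank k (⨆ p ∈ Γ, p.submodule : Submodule k (Fin (n + 1) → k)) = Γ.card) ∨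
  (n + 1 ≤ Γ.card ∧
    ∀ S ⊆ Γ, S.card = n + 1 →
      ¬ ∃ l : Module.Dual k (Fin (n + 1) → k), l ≠ 0 ∧ ∀ p ∈ S, p.submodule ≤ LinearMap.ker l)

/-- The homogeneous ideal `I(p)` of a point `p ∈ ℙⁿ`: the ideal of `k[x₀,…,xₙ]` generated by the
homogeneous polynomials that vanish at `p`. -/
def pointIdeal {k : Type*} [Field k] {n : ℕ} (p : ℙ k (Fin (n + 1) → k)) :
    Ideal (MvPolynomial (Fin (n + 1)) k) :=
  Ideal.span {f | (∃ d : ℕ, f.IsHomogeneous d) ∧ MvPolynomial.eval p.rep f = 0}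

/-- The defining ideal `⋂ I(p)` of a finite set of points. -/
def definingIdeal {k : Type*} [Field k] {n : ℕ} (Γ : Finset (ℙ k (Fin (n + 1) → k))) :
    Ideal (MvPolynomial (Fin (n + 1)) k) :=
  ⨅ p ∈ Γ, pointIdeal p

/-- The Jacobian matrix `(∂gᵢ/∂xⱼ)` of a family of polynomials. -/
def jacobianMatrix {k : Type*} [CommRing k] {ι σ : Type*} (g : ι → MvPolynomial σ k) :
    Matrix ι σ (MvPolynomial σ k) :=
  Matrix.of fun i j => MvPolynomial.pderiv j (g i)

/-- The ideal `I_r(A)` generated by the `r`-minors of `A`. Rows and columns are picked by arbitrary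
maps: a repeated row or column gives the determinant `0` and a reordering only changes the sign,
so the ideal is the usual one. -/
def minorsIdeal {R : Type*} [CommRing R] {ι κ : Type*} (r : ℕ) (A : Matrix ι κ R) : Ideal R :=
  Ideal.span {d | ∃ (e : Fin r → ι) (f : Fin r → κ), d = (A.submatrix e f).det}

/-- The Valabrega–Valla module `⨁_{t ≥ 2} (J ∩ Iᵗ) / (J Iᵗ⁻¹)` of a pair of ideals `J ⊆ I`. -/
abbrev ValabregaValla {R : Type*} [CommRing R] (J I : Ideal R) : Type _ :=
  DirectSum {t : ℕ // 2 ≤ t} fun t =>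
    (↥(J ⊓ I ^ (t : ℕ)) ⧸ Submodule.submoduleOf (J * I ^ ((t : ℕ) - 1)) (J ⊓ I ^ (t : ℕ)))

/-- A pair of ideals `J ⊆ I` is Aluffi torsion-free if its Valabrega–Valla module is zero. -/
def IsAluffiTorsionFree {R : Type*} [CommRing R] (J I : Ideal R) : Prop :=
  J ≤ I ∧ Subsingleton (ValabregaValla J I)

end AluffiPoints

end

open scoped LinearAlgebra.Projectivization

noncomputable section

namespace AluffiPoints

open MvPolynomial

/-! ### Homogeneous ideals of points, and linear forms. -/

section PointIdeals

attribute [local instance] MvPolynomial.gradedAlgebra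

variable {k : Type*} [Field k] {n : ℕ}

/-! Let `𝔪` be the irrelevant ideal. The Jacobian ideal equals `J + 𝔪ⁿ` (`jacobianIdeal_eq`). Since
`J ⊆ 𝔪²`, the minors lie in `𝔪ⁿ`. Conversely, each point has a form of degree `n` in the Jacobian
ideal vanishing at exactly the other points (`exists_mem_jacobian_separating`), and interpolation
reduces every form of degree `n` to these modulo `J`.

Also `J ∩ 𝔪ⁿ⁺ʲ ⊆ J 𝔪ʲ` (`definingIdeal_inf_pow_le`), by an explicit interpolation formula. Now `Iᵗ⁺¹
⊆ J Iᵗ + 𝔪ⁿ⁽ᵗ⁺¹⁾`; if `a + b ∈ J` is split accordingly, then `b ∈ J ∩ 𝔪ⁿ⁺ⁿᵗ ⊆ J 𝔪ⁿᵗ ⊆ J Iᵗ`. -/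

lemma eval_eq_zero_of_mem_pointIdeal {p : ℙ k (Fin (n + 1) → k)}
    {f : MvPolynomial (Fin (n + 1)) k} (hf : f ∈ pointIdeal p) : eval p.rep f = 0 := by
  have h : pointIdeal p ≤ RingHom.ker (eval p.rep) :=
    Ideal.span_le.2 fun g hg => hg.2
  exact h hf

lemma homogeneousComponent_mem_pointIdeal {p : ℙ k (Fin (n + 1) → k)}
    {f : MvPolynomial (Fin (n + 1)) k} (hf : f ∈ pointIdeal p) (d : ℕ) :
    homogeneousComponent d f ∈ pointIdeal p :=
  homogeneousComponent_mem_of_mem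
    (Ideal.homogeneous_span (homogeneousSubmodule (Fin (n + 1)) k) _ fun _ hg => hg.1) hf d

lemma mem_definingIdeal {Γ : Finset (ℙ k (Fin (n + 1) → k))}
    {f : MvPolynomial (Fin (n + 1)) k} :
    f ∈ definingIdeal Γ ↔ ∀ p ∈ Γ, f ∈ pointIdeal p := by
  simp [definingIdeal, Submodule.mem_iInf]

lemma _root_.MvPolynomial.IsHomogeneous.mem_definingIdeal_iff
    {Γ : Finset (ℙ k (Fin (n + 1) → k))}
    {f : MvPolynomial (Fin (n + 1)) k} {d : ℕ} (hf : f.IsHomogeneous d) :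
    f ∈ definingIdeal Γ ↔ ∀ p ∈ Γ, eval p.rep f = 0 :=
  mem_definingIdeal.trans
    ⟨fun h p hp => eval_eq_zero_of_mem_pointIdeal (h p hp),
      fun h p hp => Ideal.subset_span ⟨⟨d, hf⟩, h p hp⟩⟩

lemma homogeneousComponent_mem_definingIdeal {Γ : Finset (ℙ k (Fin (n + 1) → k))}
    {f : MvPolynomial (Fin (n + 1)) k} (hf : f ∈ definingIdeal Γ) (d : ℕ) :
    homogeneousComponent d f ∈ definingIdeal Γ :=
  mem_definingIdeal.2 fun p hp =>
    homogeneousComponent_mem_pointIdeal (mem_definingIdeal.1 hf p hp) d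

/-- The linear form `∑ aᵢ xᵢ` with coefficient vector `a`. -/
def linForm (a : Fin (n + 1) → k) : MvPolynomial (Fin (n + 1)) k :=
  ∑ i, C (a i) * X i

@[simp]
lemma eval_linForm (a v : Fin (n + 1) → k) : eval v (linForm a) = a ⬝ᵥ v := by
  simp [linForm, dotProduct]

lemma isHomogeneous_linForm (a : Fin (n + 1) → k) : (linForm a).IsHomogeneous 1 :=
  IsHomogeneous.sum _ _ _ fun i _ => isHomogeneous_C_mul_X _ i

@[simp]
lemma pderiv_linForm (a : Fin (n + 1) → k) (j : Fin (n + 1)) :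
    pderiv j (linForm a) = C (a j) := by
  simp [linForm, pderiv_X, Pi.single_apply]

lemma linForm_mem_idealOfVars (a : Fin (n + 1) → k) :
    linForm a ∈ idealOfVars (Fin (n + 1)) k :=
  Ideal.sum_mem _ fun i _ => Ideal.mul_mem_left _ _ (Ideal.subset_span ⟨i, rfl⟩)

end PointIdeals

/-! ### Separation by hyperplanes in general linear position. -/

section GeneralPosition

variable {k : Type*} [Field k] {n : ℕ} {Γ : Finset (ℙ k (Fin (n + 1) → k))}

/-- A linear form that vanishes at `n + 1` points of a set in general linear position is zero. -/
lemma InGeneralLinearPosition.eq_zero_of_dotProduct_eq_zero (hΓ : InGeneralLinearPosition Γ)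
    {S : Finset (ℙ k (Fin (n + 1) → k))} (hS : S ⊆ Γ) (hcard : S.card = n + 1)
    {a : Fin (n + 1) → k} (ha : ∀ p ∈ S, a ⬝ᵥ p.rep = 0) : a = 0 := by
  by_contra hne
  rcases hΓ with ⟨h, -⟩ | ⟨-, h⟩
  · have := Finset.card_le_card hS
    omega
  · refine h S hS hcard ⟨dotProductEquiv k (Fin (n + 1)) a, by simpa using hne, fun p hp => ?_⟩
    rw [Projectivization.submodule_eq, Submodule.span_singleton_le_iff_mem]
    simpa using ha p hp

/-- In a set of at least `n + 1` points in general linear position, any point is separated by a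
linear form from any `n` of the others. -/
lemma InGeneralLinearPosition.exists_dotProduct_eq_one (hΓ : InGeneralLinearPosition Γ)
    (hn : n + 1 ≤ Γ.card) {S : Finset (ℙ k (Fin (n + 1) → k))} (hS : S ⊆ Γ)
    (hcard : S.card ≤ n) {p : ℙ k (Fin (n + 1) → k)} (hp : p ∈ Γ) (hpS : p ∉ S) :
    ∃ a : Fin (n + 1) → k, a ⬝ᵥ p.rep = 1 ∧ ∀ q ∈ S, a ⬝ᵥ q.rep = 0 := by
  classical
  obtain ⟨T, hST, hT, hTn⟩ := Finset.exists_subsuperset_card_eq (n := n)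
    (Finset.subset_erase.2 ⟨hS, hpS⟩) hcard (by rw [Finset.card_erase_of_mem hp]; omega)
  have hpT : p ∉ T := fun h => Finset.notMem_erase p Γ (hT h)
  let φ : (Fin (n + 1) → k) →ₗ[k] (T → k) :=
    LinearMap.pi fun q => (dotProductEquiv k (Fin (n + 1)) q.1.rep)
  -- The `n` points of `T` impose `n` conditions on `n + 1` coefficients. A nonzero solution cannot
  -- vanish at `p` as well.
  obtain ⟨a, ha, ha0⟩ : ∃ a ∈ LinearMap.ker φ, a ≠ 0 := by
    refine (Submodule.ne_bot_iff _).1 (LinearMap.ker_ne_bot_of_finrank_lt ?_)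
    simp [hTn]
  have haT : ∀ q ∈ T, a ⬝ᵥ q.rep = 0 := fun q hq => by
    have := congrFun (LinearMap.mem_ker.1 ha) ⟨q, hq⟩
    rw [dotProduct_comm]
    simpa [φ] using this
  have hap : a ⬝ᵥ p.rep ≠ 0 := fun h => ha0 <|
    hΓ.eq_zero_of_dotProduct_eq_zero (S := insert p T)
      (Finset.insert_subset hp (hT.trans (Finset.erase_subset _ _)))
      (by rw [Finset.card_insert_of_notMem hpT, hTn])
      (by simpa [h] using haT)
  exact ⟨(a ⬝ᵥ p.rep)⁻¹ • a, by simp [hap], fun q hq => by simp [haT q (hST hq)]⟩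

/-- The points of a set in general linear position with at least `n + 1` elements lie on no
hyperplane, so the defining ideal starts in degree two. -/
lemma InGeneralLinearPosition.definingIdeal_le (hΓ : InGeneralLinearPosition Γ)
    (hn : n + 1 ≤ Γ.card) : definingIdeal Γ ≤ idealOfVars (Fin (n + 1)) k ^ 2 := by
  intro f hf
  obtain ⟨S, hS, hSn⟩ := Finset.exists_subset_card_eq hn
  obtain ⟨p, hp⟩ : Γ.Nonempty := Finset.card_pos.1 (by omega)
  rw [mem_pow_idealOfVars_iff']
  have heval (d : ℕ) : ∀ q ∈ Γ, eval q.rep (homogeneousComponent d f) = 0 :=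
    (homogeneousComponent_isHomogeneous d f).mem_definingIdeal_iff.1
      (homogeneousComponent_mem_definingIdeal hf d)
  have h1 : homogeneousComponent 1 f = linForm fun i => coeff (Finsupp.single i 1) f := by
    ext x
    rw [coeff_homogeneousComponent, linForm, coeff_sum]
    split_ifs with hx
    · obtain ⟨i, rfl⟩ := Finsupp.range_single_one.ge hx
      simp [coeff_C_mul, coeff_X, Finsupp.single_left_inj]
    · refine (Finset.sum_eq_zero fun i _ => ?_).symm
      rw [coeff_C_mul, coeff_X, if_neg, mul_zero]
      rintro rfl
      simp at hx
  intro x hx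
  obtain h0 | h0 : x.degree = 0 ∨ x.degree = 1 := by omega
  · obtain rfl := (Finsupp.degree_eq_zero_iff x).1 h0
    simpa using heval 0 p hp
  · obtain ⟨i, rfl⟩ := Finsupp.range_single_one.ge h0
    have := hΓ.eq_zero_of_dotProduct_eq_zero hS hSn
      (a := fun i => coeff (Finsupp.single i 1) f) fun q hq => by
        rw [← eval_linForm, ← h1, heval 1 q (hS hq)]
    exact congrFun this i

end GeneralPosition

/-! ### Jacobian minors and their degrees. -/

section Minors

/-- The minors of the Jacobian matrix of elements of the ideal `(g)` lie in the Jacobian ideal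
of `g`, so that this ideal does not depend on the generators. -/
lemma det_pderiv_mem {k σ ι : Type*} [CommRing k] [Fintype ι] {r : ℕ}
    (g : ι → MvPolynomial σ k) (Q : Fin r → MvPolynomial σ k)
    (hQ : ∀ s, Q s ∈ Ideal.span (Set.range g)) (c : Fin r → σ) :
    (Matrix.of fun s t => pderiv (c t) (Q s)).det ∈
      Ideal.span (Set.range g) ⊔ minorsIdeal r (jacobianMatrix g) := by
  classical
  choose a ha using fun s => Ideal.mem_span_range_iff_exists_fun.1 (hQ s)
  rw [sup_comm, ← Ideal.mem_quotient_iff_mem_sup]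
  set π := Ideal.Quotient.mk (Ideal.span (Set.range g))
  have hg (i : ι) : π (g i) = 0 :=
    Ideal.Quotient.eq_zero_iff_mem.2 (Ideal.subset_span ⟨i, rfl⟩)
  -- Modulo `(g)` the Leibniz terms `gᵢ ∂aᵢ` vanish, so the gradients of `Q s` are combinations of
  -- those of `g`; multilinearity of the determinant finishes.
  have hrow : π.mapMatrix (Matrix.of fun s t => pderiv (c t) (Q s)) =
      fun s => ∑ i, π (a s i) • fun t => π (pderiv (c t) (g i)) := by
    ext s t
    simp [← ha s, Derivation.leibniz, hg, Finset.sum_apply]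
  rw [RingHom.map_det, hrow]
  change Matrix.detRowAlternating.toMultilinearMap
    (fun s => ∑ i, π (a s i) • fun t => π (pderiv (c t) (g i))) ∈ _
  rw [MultilinearMap.map_sum]
  refine Ideal.sum_mem _ fun e _ => ?_
  rw [MultilinearMap.map_smul_univ]
  refine Ideal.mul_mem_left _ _ ?_
  have : π ((jacobianMatrix g).submatrix e c).det ∈
      (minorsIdeal r (jacobianMatrix g)).map π :=
    Ideal.mem_map_of_mem _ (Ideal.subset_span ⟨e, c, rfl⟩)
  rwa [RingHom.map_det] at this

lemma minorsIdeal_le_pow {R ι κ : Type*} [CommRing R] {I : Ideal R} {A : Matrix ι κ R}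
    (hA : ∀ i j, A i j ∈ I) (r : ℕ) : minorsIdeal r A ≤ I ^ r := by
  refine Ideal.span_le.2 ?_
  rintro _ ⟨e, f, rfl⟩
  rw [Matrix.det_apply]
  refine Ideal.sum_mem _ fun τ _ => Submodule.smul_of_tower_mem _ _ ?_
  simpa using Ideal.prod_mem_prod (s := Finset.univ) (I := fun _ : Fin r => I)
    (x := fun i => A.submatrix e f (τ i) i) fun i _ => hA _ _

lemma derivation_mem_of_mem_sq {k A : Type*} [CommRing k] [CommRing A] [Algebra k A]
    (D : Derivation k A A) {I : Ideal A} {f : A} (hf : f ∈ I ^ 2) : D f ∈ I := by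
  rw [pow_two] at hf
  refine Submodule.mul_induction_on hf (fun a ha b hb => ?_) fun a b ha hb => ?_
  · rw [Derivation.leibniz]
    exact add_mem (I.mul_mem_right _ ha) (I.mul_mem_right _ hb)
  · rw [map_add]
    exact add_mem ha hb

end Minors

/-! ### Interpolation modulo `J 𝔪ʲ`. -/

section Generation

variable {k : Type*} [Field k] {n : ℕ} {Γ : Finset (ℙ k (Fin (n + 1) → k))}

/-- A polynomial of degree `d + 1` that is homogeneous is a combination of products of a variable
and a form of degree `d`. -/
lemma isHomogeneous_succ_induction {σ R : Type*} [CommSemiring R] {d : ℕ}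
    {P : MvPolynomial σ R → Prop} (h0 : P 0) (hadd : ∀ f g, P f → P g → P (f + g))
    (hmul : ∀ i g, g.IsHomogeneous d → P (X i * g)) {f : MvPolynomial σ R}
    (hf : f.IsHomogeneous (d + 1)) : P f := by
  rw [f.as_sum]
  refine Finset.sum_induction _ P hadd h0 fun x hx => ?_
  have hd : x.degree = d + 1 := (hf.degree_eq_sum_deg_support hx).symm
  obtain ⟨i, hi⟩ : ∃ i, x i ≠ 0 := by
    by_contra! h
    obtain rfl : x = 0 := Finsupp.ext h
    simp at hd
  obtain ⟨y, rfl⟩ := le_iff_exists_add.1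
    (Finsupp.single_le_iff.2 (Nat.one_le_iff_ne_zero.2 hi))
  have : monomial (Finsupp.single i 1 + y) (coeff (Finsupp.single i 1 + y) f) =
      X i * monomial y (coeff (Finsupp.single i 1 + y) f) := by
    rw [X, monomial_mul, one_mul]
  rw [this]
  refine hmul i _ (isHomogeneous_monomial _ ?_)
  rw [map_add, Finsupp.degree_single] at hd
  omega

/-- Suppose `h p`, `e p` are forms of degrees `1`, `d` such that `h p` is `1` at `p` and `e p` is
the indicator function of `p` on `Γ`. Modulo `J 𝔪ʲ`, where `J` is the defining ideal, every form of
degree `d + 1 + j` is the interpolating combination of the forms `e p * h p ^ (j + 1)`. -/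
lemma sub_interpolation_mem [DecidableEq (ℙ k (Fin (n + 1) → k))]
    {h : ℙ k (Fin (n + 1) → k) → Fin (n + 1) → k}
    {e : ℙ k (Fin (n + 1) → k) → MvPolynomial (Fin (n + 1)) k} {d : ℕ}
    (hh : ∀ p ∈ Γ, h p ⬝ᵥ p.rep = 1) (hed : ∀ p ∈ Γ, (e p).IsHomogeneous d)
    (he : ∀ p ∈ Γ, ∀ q ∈ Γ, eval q.rep (e p) = if q = p then 1 else 0) (j : ℕ)
    {f : MvPolynomial (Fin (n + 1)) k} (hf : f.IsHomogeneous (d + 1 + j)) :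
    f - ∑ p ∈ Γ, C (eval p.rep f) * (e p * linForm (h p) ^ (j + 1)) ∈
      definingIdeal Γ * idealOfVars (Fin (n + 1)) k ^ j := by
  induction j generalizing f with
  | zero =>
    have hom : (f - ∑ p ∈ Γ, C (eval p.rep f) * (e p * linForm (h p) ^ (0 + 1))).IsHomogeneous
        (d + 1) := by
      refine hf.sub (IsHomogeneous.sum _ _ _ fun p hp => IsHomogeneous.C_mul ?_ _)
      simpa using (hed p hp).mul (isHomogeneous_linForm (h p))
    rw [pow_zero, Ideal.one_eq_top, Ideal.mul_top, hom.mem_definingIdeal_iff]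
    intro q hq
    rw [map_sub, map_sum, Finset.sum_eq_single q]
    · simp [he q hq q hq, hh q hq]
    · intro p hp hpq
      simp [he p hp q hq, hpq.symm]
    · simp [hq]
  | succ j ih =>
    refine isHomogeneous_succ_induction
      (P := fun f => f - ∑ p ∈ Γ, C (eval p.rep f) * (e p * linForm (h p) ^ (j + 1 + 1)) ∈
        definingIdeal Γ * idealOfVars (Fin (n + 1)) k ^ (j + 1)) ?_ ?_ ?_ hf
    · simp
    · intro f g hf hg
      convert add_mem hf hg using 1
      simp only [map_add, add_mul, Finset.sum_add_distrib]
      ring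
    · intro i g hg
      -- The correction `e p * (X i - C (p.rep i) * linForm (h p))` lies in `J`: its second factor
      -- vanishes at `p`, its first at the other points.
      have key : X i * g - ∑ p ∈ Γ, C (eval p.rep (X i * g)) *
            (e p * linForm (h p) ^ (j + 1 + 1)) =
          (g - ∑ p ∈ Γ, C (eval p.rep g) * (e p * linForm (h p) ^ (j + 1))) * X i +
          ∑ p ∈ Γ, C (eval p.rep g) * ((e p * (X i - C (p.rep i) * linForm (h p))) *
            linForm (h p) ^ (j + 1)) := by
        rw [sub_mul, sub_add, mul_comm g, sub_right_inj, Finset.sum_mul, ← Finset.sum_sub_distrib]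
        refine Finset.sum_congr rfl fun p _ => ?_
        simp only [map_mul, eval_X]
        ring
      rw [key]
      refine add_mem ?_ (Ideal.sum_mem _ fun p hp => Ideal.mul_mem_left _ _ ?_)
      · rw [pow_succ, ← mul_assoc]
        exact Ideal.mul_mem_mul (ih hg) (Ideal.subset_span ⟨i, rfl⟩)
      · refine Ideal.mul_mem_mul ?_ (Ideal.pow_mem_pow (linForm_mem_idealOfVars _) _)
        have hom : (e p * (X i - C (p.rep i) * linForm (h p))).IsHomogeneous (d + 1) :=
          (hed p hp).mul ((isHomogeneous_X _ i).sub ((isHomogeneous_linForm _).C_mul _))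
        rw [hom.mem_definingIdeal_iff]
        intro q hq
        by_cases hqp : q = p
        · subst hqp
          simp [hh q hq]
        · simp [he p hp q hq, hqp]

end Generation

/-! ### Separating forms from gradients of rank-two quadrics. -/

section SeparatingMinors

variable {k : Type*} [Field k] {n : ℕ} {Γ : Finset (ℙ k (Fin (n + 1) → k))}

/-- The determinant with first row `c` and remaining rows the gradients of the products of linear
forms `linForm (A s) * linForm (B s)`. -/
def gradDet (c : Fin (n + 1) → k) (A B : Fin n → Fin (n + 1) → k) :
    MvPolynomial (Fin (n + 1)) k :=
  (Matrix.of (Fin.cons (fun i => C (c i))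
    fun s i => pderiv i (linForm (A s) * linForm (B s))) :
      Matrix (Fin (n + 1)) (Fin (n + 1)) (MvPolynomial (Fin (n + 1)) k)).det

lemma isHomogeneous_gradDet (c : Fin (n + 1) → k) (A B : Fin n → Fin (n + 1) → k) :
    (gradDet c A B).IsHomogeneous n := by
  -- After transposing, factor `i` of each product comes from row `i`: degree 0 for row 0, degree 1
  -- for the others.
  rw [gradDet, ← Matrix.det_transpose, Matrix.det_apply, ← mem_homogeneousSubmodule]
  refine sum_mem fun τ _ => Submodule.smul_of_tower_mem _ _ ?_
  rw [mem_homogeneousSubmodule]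
  have hdeg : ∑ i : Fin (n + 1), (Fin.cons 0 (fun _ => 1) : Fin (n + 1) → ℕ) i = n := by
    simp [Fin.sum_univ_succ]
  refine (congrArg _ hdeg).mp (IsHomogeneous.prod _ _ _ fun i _ => ?_)
  refine Fin.cases ?_ (fun s => ?_) i
  · simpa using isHomogeneous_C _ _
  · simp only [Matrix.transpose_apply, Matrix.of_apply, Fin.cons_succ, Derivation.leibniz,
      pderiv_linForm, smul_eq_mul]
    exact ((isHomogeneous_linForm _).mul (isHomogeneous_C _ _)).add
      ((isHomogeneous_linForm _).mul (isHomogeneous_C _ _))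

lemma eval_gradDet (c : Fin (n + 1) → k) (A B : Fin n → Fin (n + 1) → k) (v : Fin (n + 1) → k) :
    eval v (gradDet c A B) =
      (Matrix.of (Fin.cons c fun s => (A s ⬝ᵥ v) • B s + (B s ⬝ᵥ v) • A s) :
        Matrix (Fin (n + 1)) (Fin (n + 1)) k).det := by
  rw [gradDet, RingHom.map_det]
  congr 1
  ext i j
  refine Fin.cases ?_ (fun s => ?_) i <;> simp [Derivation.leibniz]

/-- The cofactors of the constant row are `n`-minors of gradients of elements of `(g)`. -/
lemma gradDet_mem {ι : Type*} [Fintype ι] (g : ι → MvPolynomial (Fin (n + 1)) k)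
    (c : Fin (n + 1) → k) (A B : Fin n → Fin (n + 1) → k)
    (hAB : ∀ s, linForm (A s) * linForm (B s) ∈ Ideal.span (Set.range g)) :
    gradDet c A B ∈ Ideal.span (Set.range g) ⊔ minorsIdeal n (jacobianMatrix g) := by
  rw [gradDet, Matrix.det_succ_row_zero]
  exact Ideal.sum_mem _ fun j _ => Ideal.mul_mem_left _ _ (det_pderiv_mem g _ hAB j.succAbove)

/-- If all quadrics `A s * B s` pass through `v ≠ 0` and `c` vanishes at `v`, so does the
determinant, whose rows are then orthogonal to `v`. -/
lemma eval_gradDet_eq_zero_of_dotProduct_eq_zero {c : Fin (n + 1) → k}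
    {A B : Fin n → Fin (n + 1) → k} {v : Fin (n + 1) → k} (hv : v ≠ 0) (hc : c ⬝ᵥ v = 0)
    (hAB : ∀ s, A s ⬝ᵥ v = 0 ∨ B s ⬝ᵥ v = 0) : eval v (gradDet c A B) = 0 := by
  rw [eval_gradDet, ← Matrix.exists_mulVec_eq_zero_iff]
  refine ⟨v, hv, funext fun i => ?_⟩
  refine Fin.cases ?_ (fun s => ?_) i
  · simpa [Matrix.mulVec] using hc
  · change ((A s ⬝ᵥ v) • B s + (B s ⬝ᵥ v) • A s) ⬝ᵥ v = 0
    rcases hAB s with h | h <;> simp [h]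

/-- The determinant vanishes at a point where one of the quadrics `A s * B s` is singular. -/
lemma eval_gradDet_eq_zero_of_singular {c : Fin (n + 1) → k}
    {A B : Fin n → Fin (n + 1) → k} {v : Fin (n + 1) → k} {s : Fin n}
    (hA : A s ⬝ᵥ v = 0) (hB : B s ⬝ᵥ v = 0) : eval v (gradDet c A B) = 0 := by
  rw [eval_gradDet]
  exact Matrix.det_eq_zero_of_row_eq_zero s.succ fun j => by simp [hA, hB]

/-- At `v` the rows become `c` and the `A s`, which are independent: testing a relation on `v`
isolates the coefficient of `c`, then `w t` that of `A t`. -/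
lemma eval_gradDet_ne_zero {c : Fin (n + 1) → k}
    {A B : Fin n → Fin (n + 1) → k} {v : Fin (n + 1) → k} {w : Fin n → Fin (n + 1) → k}
    (hc : c ⬝ᵥ v = 1) (hA : ∀ s, A s ⬝ᵥ v = 0) (hB : ∀ s, B s ⬝ᵥ v = 1)
    (hAw : ∀ s t, A s ⬝ᵥ w t = if s = t then 1 else 0) : eval v (gradDet c A B) ≠ 0 := by
  rw [eval_gradDet, Ne, ← Matrix.exists_vecMul_eq_zero_iff]
  rintro ⟨x, hx0, hx⟩
  have hcomb (y : Fin (n + 1) → k) : x 0 * (c ⬝ᵥ y) + ∑ s, x (Fin.succ s) * (A s ⬝ᵥ y) = 0 := by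
    have := congrArg (· ⬝ᵥ y) hx
    rw [← Matrix.dotProduct_mulVec, dotProduct, Fin.sum_univ_succ] at this
    simpa [Matrix.mulVec, hA, hB] using this
  have h0 : x 0 = 0 := by simpa [hc, hA] using hcomb v
  refine hx0 (funext fun i => Fin.cases h0 (fun t => ?_) i)
  simpa [h0, hAw] using hcomb (w t)

/-- For every point `p` of a set of `n + 3` points in general linear position in `ℙⁿ`, `n ≥ 4`, the
Jacobian ideal contains a form of degree `n` that vanishes at all points of the set but `p`. -/
lemma InGeneralLinearPosition.exists_mem_jacobian_separating (hΓ : InGeneralLinearPosition Γ)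
    (hn : 4 ≤ n) (hcard : Γ.card = n + 3) {ι : Type*} [Fintype ι]
    (g : ι → MvPolynomial (Fin (n + 1)) k) (hg : Ideal.span (Set.range g) = definingIdeal Γ)
    {p : ℙ k (Fin (n + 1) → k)} (hp : p ∈ Γ) :
    ∃ M ∈ definingIdeal Γ ⊔ minorsIdeal n (jacobianMatrix g), M.IsHomogeneous n ∧
      eval p.rep M ≠ 0 ∧ ∀ q ∈ Γ, q ≠ p → eval q.rep M = 0 := by
  classical
  have hle : n + 1 ≤ Γ.card := by omega
  have hcard' : (Γ.erase p).card = n + 2 := by rw [Finset.card_erase_of_mem hp]; omega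
  let e := (Finset.equivFinOfCardEq hcard').symm
  let u : Fin n → ℙ k (Fin (n + 1) → k) := fun s => (e (s.castAdd 2)).1
  let w : Fin 2 → ℙ k (Fin (n + 1) → k) := fun j => (e (Fin.natAdd n j)).1
  have huΓ (s : Fin n) : u s ∈ Γ := Finset.mem_of_mem_erase (e _).2
  have hwΓ (j : Fin 2) : w j ∈ Γ := Finset.mem_of_mem_erase (e _).2
  have hup (s : Fin n) : u s ≠ p := Finset.ne_of_mem_erase (e _).2
  have hwp (j : Fin 2) : w j ≠ p := Finset.ne_of_mem_erase (e _).2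
  have hu : Function.Injective u := fun s t h => by
    simpa using e.injective (Subtype.ext h)
  have hall : ∀ q ∈ Γ, q ≠ p → (∃ s, q = u s) ∨ ∃ j, q = w j := by
    intro q hq hqp
    obtain ⟨x, hx⟩ := e.surjective ⟨q, Finset.mem_erase.2 ⟨hqp, hq⟩⟩
    induction x using Fin.addCases with
    | left s => exact Or.inl ⟨s, by simp [u, hx]⟩
    | right j => exact Or.inr ⟨j, by simp [w, hx]⟩
  let i₀ : Fin n := ⟨0, by omega⟩
  let i₁ : Fin n := ⟨1, by omega⟩
  have hi : i₁ ≠ i₀ := by simp [i₀, i₁]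
  -- `B s` will also vanish at `u (o s)`. Only the swap of `i₀` and `i₁` matters: it makes quadric
  -- `i₁` singular at `u i₀` and quadric `i₀` singular at `u i₁`, the two points that `c` need not
  -- kill.
  let o : Fin n → Fin n := fun s => if s = i₀ then i₁ else i₀
  have ho (s : Fin n) : o s ≠ s := by
    by_cases h : s = i₀
    · simp [o, h, hi]
    · simpa [o, h] using Ne.symm h
  have hA (s : Fin n) : ∃ a : Fin (n + 1) → k, a ⬝ᵥ p.rep = 0 ∧
      ∀ t, a ⬝ᵥ (u t).rep = if s = t then 1 else 0 := by
    obtain ⟨a, ha, h⟩ := hΓ.exists_dotProduct_eq_one hle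
      (S := insert p ((Finset.univ.erase s).image u)) (p := u s)
      (Finset.insert_subset hp (Finset.image_subset_iff.2 fun t _ => huΓ t))
      (by
        refine (Finset.card_insert_le _ _).trans ?_
        have := Finset.card_image_le (s := Finset.univ.erase s) (f := u)
        rw [Finset.card_erase_of_mem (Finset.mem_univ _), Finset.card_fin] at this
        omega)
      (huΓ s) (by simp [hup, hu.eq_iff])
    refine ⟨a, h p (by simp), fun t => ?_⟩
    split_ifs with hst
    · rw [← hst, ha]
    · exact h _ (by simp [hu.eq_iff, Ne.symm hst])
  -- Four prescribed zeros: this is where `4 ≤ n` enters.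
  have hB (s : Fin n) : ∃ b : Fin (n + 1) → k, b ⬝ᵥ p.rep = 1 ∧ b ⬝ᵥ (u s).rep = 0 ∧
      b ⬝ᵥ (u (o s)).rep = 0 ∧ ∀ j, b ⬝ᵥ (w j).rep = 0 := by
    obtain ⟨b, hb, h⟩ := hΓ.exists_dotProduct_eq_one hle
      (S := {u s, u (o s), w 0, w 1}) (p := p)
      (by simp [Finset.insert_subset_iff, huΓ, hwΓ])
      (Finset.card_le_four.trans hn) hp (by simp [(hup _).symm, (hwp _).symm])
    refine ⟨b, hb, h _ (by simp), h _ (by simp), fun j => ?_⟩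
    fin_cases j <;> exact h _ (by simp)
  -- The prescribed zeros are `n - 2` of the `u t` and both `w j`, the maximum of `n`.
  obtain ⟨c, hcp, hcu, hcw⟩ : ∃ c : Fin (n + 1) → k, c ⬝ᵥ p.rep = 1 ∧
      (∀ t, t ≠ i₀ → t ≠ i₁ → c ⬝ᵥ (u t).rep = 0) ∧ ∀ j, c ⬝ᵥ (w j).rep = 0 := by
    obtain ⟨c, hc, h⟩ := hΓ.exists_dotProduct_eq_one hle
      (S := ((Finset.univ.erase i₀).erase i₁).image u ∪ Finset.univ.image w) (p := p)
      (Finset.union_subset (Finset.image_subset_iff.2 fun t _ => huΓ t)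
        (Finset.image_subset_iff.2 fun t _ => hwΓ t))
      (by
        refine (Finset.card_union_le _ _).trans ?_
        have h1 := Finset.card_image_le (s := (Finset.univ.erase i₀).erase i₁) (f := u)
        have h2 := Finset.card_image_le (s := Finset.univ) (f := w)
        rw [Finset.card_erase_of_mem (by simp [hi]),
          Finset.card_erase_of_mem (Finset.mem_univ _), Finset.card_fin] at h1
        rw [Finset.card_fin] at h2
        omega)
      hp (by simp [hup, hwp])
    exact ⟨c, hc, fun t h0 h1 => h _ (Finset.mem_union_left _
      (Finset.mem_image_of_mem _ (by simp [h0, h1]))),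
      fun j => h _ (Finset.mem_union_right _ (Finset.mem_image_of_mem _ (Finset.mem_univ _)))⟩
  choose A hAp hAu using hA
  choose B hBp hBu hBo hBw using hB
  have hABu (s t : Fin n) : A s ⬝ᵥ (u t).rep = 0 ∨ B s ⬝ᵥ (u t).rep = 0 := by
    by_cases h : s = t
    · exact Or.inr (h ▸ hBu s)
    · exact Or.inl (by rw [hAu, if_neg h])
  have hAB (s : Fin n) : linForm (A s) * linForm (B s) ∈ Ideal.span (Set.range g) := by
    rw [hg, ((isHomogeneous_linForm _).mul (isHomogeneous_linForm _)).mem_definingIdeal_iff]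
    intro q hq
    rw [map_mul, eval_linForm, eval_linForm, mul_eq_zero]
    by_cases hqp : q = p
    · exact Or.inl (hqp ▸ hAp s)
    · obtain ⟨t, rfl⟩ | ⟨j, rfl⟩ := hall q hq hqp
      · exact hABu s t
      · exact Or.inr (hBw s j)
  refine ⟨gradDet c A B, hg ▸ gradDet_mem g c A B hAB, isHomogeneous_gradDet c A B,
    eval_gradDet_ne_zero hcp hAp hBp (w := fun t => (u t).rep) hAu, fun q hq hqp => ?_⟩
  obtain ⟨t, rfl⟩ | ⟨j, rfl⟩ := hall q hq hqp
  · by_cases h0 : t = i₀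
    · have ho₁ : o i₁ = t := by simp [o, hi, h0]
      refine eval_gradDet_eq_zero_of_singular (s := i₁) ?_ (ho₁ ▸ hBo i₁)
      rw [hAu, if_neg (h0 ▸ hi)]
    by_cases h1 : t = i₁
    · have ho₀ : o i₀ = t := by simp [o, h1]
      refine eval_gradDet_eq_zero_of_singular (s := i₀) ?_ (ho₀ ▸ hBo i₀)
      rw [hAu, if_neg (Ne.symm h0)]
    · exact eval_gradDet_eq_zero_of_dotProduct_eq_zero (u t).rep_nonzero (hcu t h0 h1)
        fun s => hABu s t
  · exact eval_gradDet_eq_zero_of_dotProduct_eq_zero (w j).rep_nonzero (hcw j)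
      fun s => Or.inr (hBw s j)

end SeparatingMinors

/-! ### The Jacobian ideal as `J + 𝔪ⁿ`, and degrees of generators of `J`. -/

section JacobianIdeal

variable {k : Type*} [Field k] {n : ℕ} {Γ : Finset (ℙ k (Fin (n + 1) → k))}

/-- The Jacobian ideal of `n + 3` points in general linear position in `ℙⁿ`, `n ≥ 4`, is `J + 𝔪ⁿ`,
where `J` is the defining ideal and `𝔪` the irrelevant ideal. -/
lemma InGeneralLinearPosition.jacobianIdeal_eq (hΓ : InGeneralLinearPosition Γ)
    (hn : 4 ≤ n) (hcard : Γ.card = n + 3) {ι : Type*} [Fintype ι]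
    (g : ι → MvPolynomial (Fin (n + 1)) k) (hg : Ideal.span (Set.range g) = definingIdeal Γ) :
    definingIdeal Γ ⊔ minorsIdeal n (jacobianMatrix g) =
      definingIdeal Γ ⊔ idealOfVars (Fin (n + 1)) k ^ n := by
  refine le_antisymm (sup_le_sup_left (minorsIdeal_le_pow (fun i j => ?_) n) _)
    (sup_le le_sup_left ?_)
  · refine derivation_mem_of_mem_sq (pderiv j) (hΓ.definingIdeal_le (by omega) ?_)
    exact hg ▸ Ideal.subset_span ⟨i, rfl⟩
  choose! M hM hMd hMp hMq using fun p (hp : p ∈ Γ) =>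
    hΓ.exists_mem_jacobian_separating hn hcard g hg hp
  rw [pow_idealOfVars_eq_span, Ideal.span_le]
  rintro _ ⟨x, hx, rfl⟩
  have hF : (monomial x (1 : k)).IsHomogeneous n := isHomogeneous_monomial _ hx
  set F := monomial x (1 : k)
  have hJ : F - ∑ p ∈ Γ, C (eval p.rep F / eval p.rep (M p)) * M p ∈ definingIdeal Γ := by
    rw [(hF.sub (IsHomogeneous.sum _ _ _ fun p hp =>
      (hMd p hp).C_mul _)).mem_definingIdeal_iff]
    intro q hq
    rw [map_sub, map_sum, Finset.sum_eq_single q]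
    · simp [hMp q hq]
    · intro p hp hpq
      simp [hMq p hp q hq hpq.symm]
    · simp [hq]
  change F ∈ _
  rw [← sub_add_cancel F (∑ p ∈ Γ, C (eval p.rep F / eval p.rep (M p)) * M p)]
  exact add_mem (Ideal.mem_sup_left hJ)
    (Ideal.sum_mem _ fun p hp => Ideal.mul_mem_left _ _ (hM p hp))

/-- The defining ideal of `n + 3` points in general linear position is generated in degrees at most
`n`, for `n ≥ 3`. -/
lemma InGeneralLinearPosition.definingIdeal_inf_pow_le (hΓ : InGeneralLinearPosition Γ)
    (hn : 3 ≤ n) (hcard : Γ.card = n + 3) (j : ℕ) :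
    definingIdeal Γ ⊓ idealOfVars (Fin (n + 1)) k ^ (n + j) ≤
      definingIdeal Γ * idealOfVars (Fin (n + 1)) k ^ j := by
  classical
  have hle : n + 1 ≤ Γ.card := by omega
  -- The other `n + 2` points are split between two hyperplanes missing `p`: `n` on the first, 2 on
  -- the second.
  have hsep : ∀ p ∈ Γ, ∃ a b : Fin (n + 1) → k, a ⬝ᵥ p.rep = 1 ∧ b ⬝ᵥ p.rep = 1 ∧
      ∀ q ∈ Γ, q ≠ p → a ⬝ᵥ q.rep = 0 ∨ b ⬝ᵥ q.rep = 0 := by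
    intro p hp
    have hcard' : (Γ.erase p).card = n + 2 := by rw [Finset.card_erase_of_mem hp]; omega
    obtain ⟨S, hS, hSn⟩ := Finset.exists_subset_card_eq (s := Γ.erase p) (n := n) (by omega)
    obtain ⟨a, hap, ha⟩ := hΓ.exists_dotProduct_eq_one hle (hS.trans (Finset.erase_subset _ _))
      hSn.le hp fun h => Finset.notMem_erase p Γ (hS h)
    obtain ⟨b, hbp, hb⟩ := hΓ.exists_dotProduct_eq_one hle (S := Γ.erase p \ S)
      (Finset.sdiff_subset.trans (Finset.erase_subset _ _))
      (by rw [Finset.card_sdiff_of_subset hS]; omega) hp (by simp)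
    refine ⟨a, b, hap, hbp, fun q hq hqp => ?_⟩
    by_cases hqS : q ∈ S
    · exact Or.inl (ha q hqS)
    · exact Or.inr (hb q (by simp [hq, hqp, hqS]))
  choose! a b ha hb hab using hsep
  rintro f ⟨hfJ, hfm⟩
  rw [SetLike.mem_coe, mem_pow_idealOfVars_iff'] at hfm
  rw [← sum_homogeneousComponent f]
  refine Ideal.sum_mem _ fun d _ => ?_
  obtain hd | hd := lt_or_ge d (n + j)
  · suffices homogeneousComponent d f = 0 from this ▸ zero_mem _
    ext x
    rw [coeff_homogeneousComponent, coeff_zero]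
    split_ifs with hx
    · exact hfm x (hx ▸ hd)
    · rfl
  obtain ⟨i, rfl⟩ := Nat.exists_eq_add_of_le hd
  have hom := homogeneousComponent_isHomogeneous (n + j + i) f
  have hzero := hom.mem_definingIdeal_iff.1 (homogeneousComponent_mem_definingIdeal hfJ _)
  -- The power `n - 2` pads the indicator to degree `n - 1`; it is positive as `3 ≤ n`, so the zeros
  -- of `a p` survive. The interpolant itself is 0, since the component vanishes on `Γ`.
  have := sub_interpolation_mem (Γ := Γ) (h := a) (d := n - 1) (j := j + i)
    (e := fun p => linForm (a p) ^ (n - 2) * linForm (b p)) ha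
    (fun p _ => by
      have := ((isHomogeneous_linForm (a p)).pow (n - 2)).mul (isHomogeneous_linForm (b p))
      rwa [show 1 * (n - 2) + 1 = n - 1 by omega] at this)
    (fun p hp q hq => by
      split_ifs with h
      · subst h
        simp [ha q hq, hb q hq]
      · rcases hab p hp q hq h with h' | h'
        · simp [h', show n - 2 ≠ 0 by omega]
        · simp [h'])
    (f := homogeneousComponent (n + j + i) f)
    (by rwa [show n - 1 + 1 + (j + i) = n + j + i by omega])
  rw [Finset.sum_eq_zero fun p hp => by rw [hzero p hp, map_zero, zero_mul], sub_zero] at this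
  exact Ideal.mul_mono_right (Ideal.pow_le_pow_right (Nat.le_add_right j i)) this

end JacobianIdeal

/-! ### Reduction to inclusions of ideals. -/

section ValabregaValla

/-- In the expansion every term but `K ^ (t + 1)` has a factor from `J`. -/
lemma sup_pow_succ_le {R : Type*} [CommRing R] (J K : Ideal R) (t : ℕ) :
    (J ⊔ K) ^ (t + 1) ≤ J * (J ⊔ K) ^ t ⊔ K ^ (t + 1) := by
  induction t with
  | zero => simp
  | succ t ih =>
    rw [pow_succ]
    refine (Ideal.mul_mono_left ih).trans ?_
    rw [Ideal.sup_mul, mul_assoc, ← pow_succ]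
    refine sup_le le_sup_left ?_
    rw [Ideal.mul_sup, ← pow_succ, mul_comm _ J]
    exact sup_le_sup_right (Ideal.mul_mono_right (Ideal.pow_right_mono le_sup_right _)) _

lemma isAluffiTorsionFree_of_inf_pow_le {R : Type*} [CommRing R] {J I : Ideal R} (hJI : J ≤ I)
    (h : ∀ t, J ⊓ I ^ (t + 1) ≤ J * I ^ t) : IsAluffiTorsionFree J I := by
  refine ⟨hJI, ?_⟩
  have (t : {t : ℕ // 2 ≤ t}) : Subsingleton (↥(J ⊓ I ^ (t : ℕ)) ⧸
      Submodule.submoduleOf (J * I ^ ((t : ℕ) - 1)) (J ⊓ I ^ (t : ℕ))) := by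
    rw [Submodule.Quotient.subsingleton_iff, Submodule.submoduleOf,
      Submodule.comap_subtype_eq_top]
    have ht := h ((t : ℕ) - 1)
    rwa [Nat.sub_add_cancel (one_le_two.trans t.2)] at ht
  exact ⟨fun x y => DFinsupp.ext fun t => Subsingleton.elim _ _⟩

end ValabregaValla

end AluffiPoints

end

theorem proposition4p5 {k : Type*} [Field k] [IsAlgClosed k] (n : ℕ) (hn : 4 ≤ n)
    (Γ : Finset (Projectivization k (Fin (n + 1) → k))) (hcard : Γ.card = n + 3)
    (hΓ : AluffiPoints.InGeneralLinearPosition Γ)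
    (m : ℕ) (g : Fin m → MvPolynomial (Fin (n + 1)) k)
    (hg : Ideal.span (Set.range g) = AluffiPoints.definingIdeal Γ) :
    AluffiPoints.IsAluffiTorsionFree (AluffiPoints.definingIdeal Γ)
      (AluffiPoints.definingIdeal Γ ⊔
        AluffiPoints.minorsIdeal n (AluffiPoints.jacobianMatrix g)) := by
  refine AluffiPoints.isAluffiTorsionFree_of_inf_pow_le le_sup_left fun t => ?_
  rw [hΓ.jacobianIdeal_eq hn hcard g hg]
  rintro f ⟨hfJ, hf⟩
  obtain ⟨a, ha, b, hb, rfl⟩ := Submodule.mem_sup.1 (AluffiPoints.sup_pow_succ_le _ _ t hf)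
  have hbJ : b ∈ AluffiPoints.definingIdeal Γ :=
    (Submodule.add_mem_iff_right _ (Ideal.mul_le_left (I := AluffiPoints.definingIdeal Γ) ha)).1 hfJ
  refine add_mem ha (Ideal.mul_mono_right (Ideal.pow_right_mono le_sup_right t) ?_)
  -- Writing `n(t + 1) = n + nt` leaves exactly `𝔪ⁿᵗ` beside `J`.
  rw [← pow_mul, Nat.mul_succ, add_comm (n * t)] at hb
  rw [← pow_mul]
  exact hΓ.definingIdeal_inf_pow_le (by omega) hcard _ ⟨hbJ, hb⟩
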